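/- Let $X$ be a reflexive real Banach space and let $Y$ be a real Banach space that is an $L^1$-predual, i.e. $Y^*$ is isometrically isomorphic to $L^1(\mu)$ for some positive measure $\mu$. For Banach spaces $V, W$ let $\mathcal K(V,W)$ be the space of compact operators from $V$ to $W$ with the operator norm. A closed subspace $Z$ of a Banach space $E$ is called proximinal if for every $x\in E$ the set $P(x)=\{z\in Z: d(x,Z)=\|x-z\|\}$ is non-empty; a proximinal $Z$ is called strongly proximinal if for every $x\in E$ and every sequence $(y_n)$ in $Z$ with $\|x-y_n\|\to d(x,Z)$ there are a subsequence $(y_{n_j})$ and $z_j\in P(x)$ with $\|y_{n_j}-z_j\|\to 0$. Let $Z\subset Y$ be a strongly proximinal subspace of finite codimension. Then there is a smallest integer $k\ge 0$ for which there is a subspace $F\subset Y^*$, isometric to $\ell^1(k)$, with $Z^\perp\subset F$ and $Y^*=F\oplus_1 N$ for some closed subspace $N\subset Y^*$. For this $k$ and any such $F=\ell^1(k)$, suppose in addition that $\mathcal K(X,Z)^\perp\subset X\otimes_\pi \ell^1(k)$, where $\perp$ denotes the annihilator in $\mathcal K(X,Y)^*$ and where the completed projective tensor product $X\otimes_\pi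 \ell^1(k)$ is regarded as the subspace of $\mathcal K(X,Y)^*$ consisting of the functionals $T\mapsto\sum_n g_n(Tx_n)$ with $x_n\in X$, $g_n\in \ell^1(k)\subset Y^*$ and $\sum_n\|x_n\|\,\|g_n\|<\infty$. Then $\mathcal K(X,Z)$ is a proximinal subspace of $\mathcal K(X,Y)$. -/

import Mathlib

open Filter Topology MeasureTheory

/-- A real normed space is reflexive if its canonical embedding into the bidual is onto. -/
def IsReflexiveSpace (X : Type*) [NormedAddCommGroup X] [NormedSpace ℝ X] : Prop :=
  Function.Surjective (NormedSpace.inclusionInDoubleDual ℝ X)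

/-- The set `P(x)` of best approximants to `x` from the subspace `Z`. -/
def bestApproximants {E : Type*} [NormedAddCommGroup E] [NormedSpace ℝ E]
    (Z : Submodule ℝ E) (x : E) : Set E :=
  {z | z ∈ Z ∧ Metric.infDist x (Z : Set E) = ‖x - z‖}

/-- `Z` is a proximinal subspace of `E`: it is closed, and every vector of `E` has a best
approximant in `Z`. -/
def IsProximinal {E : Type*} [NormedAddCommGroup E] [NormedSpace ℝ E]
    (Z : Submodule ℝ E) : Prop :=
  IsClosed (Z : Set E) ∧ ∀ x : E, (bestApproximants Z x).Nonempty

/-- `Z` is a strongly proximinal subspace of `E`: it is proximinal, and every minimising sequence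
for `x` in `Z` has a subsequence whose distance to some sequence of best approximants of `x`
tends to `0`. -/
def IsStronglyProximinal {E : Type*} [NormedAddCommGroup E] [NormedSpace ℝ E]
    (Z : Submodule ℝ E) : Prop :=
  IsProximinal Z ∧
    ∀ (x : E) (y : ℕ → E), (∀ n, y n ∈ Z) →
      Tendsto (fun n => ‖x - y n‖) atTop (𝓝 (Metric.infDist x (Z : Set E))) →
      ∃ φ : ℕ → ℕ, StrictMono φ ∧ ∃ z : ℕ → E, (∀ j, z j ∈ bestApproximants Z x) ∧
        Tendsto (fun j => ‖y (φ j) - z j‖) atTop (𝓝 0)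

/-- `Y` is an `L¹`-predual space: `Y*` is isometrically isomorphic to `L¹(μ)` for some positive
measure `μ`, on an arbitrary measurable space `Ω` (here the type `Ω` is given). -/
def IsL1PredualVia (Y : Type*) [NormedAddCommGroup Y] [NormedSpace ℝ Y]
    {Ω : Type*} [MeasurableSpace Ω] (μ : Measure Ω) : Prop :=
  Nonempty (StrongDual ℝ Y ≃ₗᵢ[ℝ] Lp ℝ 1 μ)

/-- `F` is a copy of `ℓ¹(k)` in `E` with `E = F ⊕₁ N` for some closed subspace `N`. -/
def IsEll1Summand {E : Type*} [NormedAddCommGroup E] [NormedSpace ℝ E]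
    (k : ℕ) (F : Submodule ℝ E) : Prop :=
  Nonempty (F ≃ₗᵢ[ℝ] PiLp 1 (fun _ : Fin k => ℝ)) ∧
    ∃ N : Submodule ℝ E, IsClosed (N : Set E) ∧ IsCompl F N ∧
      ∀ f ∈ F, ∀ g ∈ N, ‖f + g‖ = ‖f‖ + ‖g‖

/-- The space `K(X, Y)` of compact operators, a subspace of the bounded operators with the
operator norm. -/
abbrev CompactOps (X Y : Type*) [NormedAddCommGroup X] [NormedSpace ℝ X]
    [NormedAddCommGroup Y] [NormedSpace ℝ Y] : Submodule ℝ (X →L[ℝ] Y) :=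
  compactOperator (RingHom.id ℝ) X Y

/-- `K(X, Z)` as a subspace of `K(X, Y)`, for a closed subspace `Z` of `Y`: the compact operators
with values in `Z`. -/
def compactOpsInto (X : Type*) {Y : Type*} [NormedAddCommGroup X] [NormedSpace ℝ X]
    [NormedAddCommGroup Y] [NormedSpace ℝ Y] (Z : Submodule ℝ Y) :
    Submodule ℝ (CompactOps X Y) where
  carrier := {T | ∀ x : X, (T : X →L[ℝ] Y) x ∈ Z}
  add_mem' hS hT x := Z.add_mem (hS x) (hT x)
  zero_mem' _ := Z.zero_mem
  smul_mem' c _ hT x := Z.smul_mem c (hT x)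

/-- For a subspace `F` of `Y*`, the completed projective tensor product of `X` and `F` inside
`K(X, Y)*`, where `x ⊗ g` acts by `T ↦ g (T x)`: the functionals
`T ↦ ∑ₙ gₙ (T xₙ)` with `xₙ ∈ X`, `gₙ ∈ F` and `∑ₙ ‖xₙ‖ ‖gₙ‖ < ∞`. -/
def projTensor (X : Type*) {Y : Type*} [NormedAddCommGroup X] [NormedSpace ℝ X]
    [NormedAddCommGroup Y] [NormedSpace ℝ Y] (F : Submodule ℝ (StrongDual ℝ Y)) :
    Set (StrongDual ℝ (CompactOps X Y)) :=
  {τ | ∃ (x : ℕ → X) (g : ℕ → StrongDual ℝ Y), (∀ n, g n ∈ F) ∧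
    Summable (fun n => ‖x n‖ * ‖g n‖) ∧
    ∀ T : CompactOps X Y, HasSum (fun n => g n ((T : X →L[ℝ] Y) (x n))) (τ T)}

/-! The core is a norm-preserving lift. If `Z^⊥` lies in an L-summand `F = ℓ¹(k)` of `Y*` with basis
`f`, then `A y = (fᵢ y)ᵢ` maps `Y` onto `ℓ^∞(k)`, `ker A ⊆ Z`, and `A` has a linear right inverse
`L` with `‖L‖ ≤ 1` (`exists_contractive_lift`). Given `T` at distance `d` from `K(X, Z)`, a
pointwise limit `R` of `A ∘ Sₙ` along a minimising sequence satisfies `‖A ∘ T - R‖ ≤ d`, and `T - L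
∘ (A ∘ T - R)` is a best approximant (`isProximinal_compactOpsInto_of_lift`).

The lift `L` is found by approximation from an M-ideal: the operators `ℓ^∞(k) → Y` killed by `A`
have an L-summand as annihilator, and an arbitrary lift of the identity is corrected by one of them
to norm at most `1`.

That such an `F` exists, so that `k` makes sense, is where strong proximinality and the `L¹`
structure enter. A functional `f ∈ Z^⊥` admits no small L-splitting
(`IsStronglyProximinal.exists_le_norm_of_split`). In `L¹(μ)` this bounds the nonzero values of `|f|
μ` away from `0`, so `f` lives on finitely many atoms. Since `Z^⊥` is finite-dimensional, finitely
many atoms serve all of it, and their band is an `ℓ¹`-summand. -/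

theorem StrongDual.norm_le_of_forall_apply_le {E : Type*} [NormedAddCommGroup E] [NormedSpace ℝ E]
    (φ : StrongDual ℝ E) {c : ℝ} (h : ∀ a, ‖a‖ ≤ 1 → φ a ≤ c) : ‖φ‖ ≤ c := by
  have hc : 0 ≤ c := by simpa using h 0 (by simp)
  refine ContinuousLinearMap.opNorm_le_of_unit_norm hc fun a ha => ?_
  rw [Real.norm_eq_abs, abs_le]
  have h1 := h a ha.le
  have h2 := h (-a) (by simp [ha])
  rw [map_neg] at h2
  constructor <;> linarith

/-! ### Best approximation from M-ideals. -/

section MIdeal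

variable {W : Type*} [NormedAddCommGroup W] [NormedSpace ℝ W]

/-- One correction step towards a best approximant from an M-ideal: `w` can be moved by a small
element of `J` to a vector of norm almost `1`. -/
theorem exists_correction_of_isLProjection (J : Submodule ℝ W)
    (P : StrongDual ℝ W → StrongDual ℝ W)
    (hP : ∀ φ, ‖P φ‖ + ‖φ - P φ‖ ≤ ‖φ‖) (hPJ : ∀ φ, ∀ j ∈ J, P φ j = 0)
    (hPeq : ∀ φ ψ : StrongDual ℝ W, (∀ j ∈ J, φ j = ψ j) → φ - P φ = ψ - P ψ) (w : W)
    (hw : ∀ φ : StrongDual ℝ W, (∀ j ∈ J, φ j = 0) → φ w ≤ ‖φ‖)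
    {δ η : ℝ} (hδ : 0 < δ) (hη : 0 < η) (hwδ : ‖w‖ ≤ 1 + δ) :
    ∃ j ∈ J, ‖w - j‖ < 1 + η ∧ ‖j‖ < δ * (1 + η) := by
  by_contra! hcon
  -- The conclusion says that the open convex set `C` meets the convex set `D` of pairs `(w - j,
  -- j)`; otherwise Hahn–Banach separates them in `W × W`.
  set C : Set (W × W) := Metric.ball 0 (1 + η) ×ˢ Metric.ball 0 (δ * (1 + η)) with hC
  set D : Set (W × W) := (fun j : W => (w - j, j)) '' (J : Set W) with hD
  have hDconv : Convex ℝ D := by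
    rintro _ ⟨i, hi, rfl⟩ _ ⟨j, hj, rfl⟩ a b ha hb hab
    refine ⟨a • i + b • j, J.add_mem (J.smul_mem _ hi) (J.smul_mem _ hj), ?_⟩
    ext
    · simp only [Prod.fst_add, Prod.smul_fst]
      calc w - (a • i + b • j) = (a + b) • w - (a • i + b • j) := by rw [hab, one_smul]
        _ = _ := by module
    · simp
  have hdisj : Disjoint C D := by
    rw [Set.disjoint_left]
    rintro _ ⟨h1, h2⟩ ⟨j, hj, rfl⟩
    simp only [mem_ball_zero_iff] at h1 h2
    exact absurd h2 (not_lt.2 (hcon j hj h1))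
  obtain ⟨Φ, u, hΦC, hΦD⟩ := geometric_hahn_banach_open
    ((convex_ball (0 : W) _).prod (convex_ball (0 : W) _))
    (Metric.isOpen_ball.prod Metric.isOpen_ball) hDconv hdisj
  set φ : StrongDual ℝ W := Φ.comp (ContinuousLinearMap.inl ℝ W W) with hφ
  set ψ : StrongDual ℝ W := Φ.comp (ContinuousLinearMap.inr ℝ W W) with hψ
  have hΦ : ∀ a b, Φ (a, b) = φ a + ψ b := fun a b => by
    simp [hφ, hψ, ← map_add]
  have hu : 0 < u := by
    have := hΦC 0 ⟨by simp; positivity, by simp; positivity⟩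
    simpa using this
  have hJ : ∀ j ∈ J, φ j = ψ j := by
    intro j hj
    -- The separating functional is bounded below along the whole line `t • j`, so its slope `ψ j -
    -- φ j` must vanish.
    have key : ∀ t : ℝ, u ≤ φ w + t * (ψ j - φ j) := fun t => by
      have := hΦD _ ⟨t • j, J.smul_mem t hj, rfl⟩
      rw [hΦ] at this
      simp only [map_sub, map_smul, smul_eq_mul] at this
      linarith
    by_contra hne
    have hne' : ψ j - φ j ≠ 0 := fun h => hne (by linarith)
    have := key ((u - φ w - 1) / (ψ j - φ j))
    rw [div_mul_cancel₀ _ hne'] at this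
    linarith
  have huw : u ≤ φ w := by
    have := hΦD _ ⟨0, J.zero_mem, rfl⟩
    rw [hΦ] at this
    simpa using this
  -- The factor `1 + η / 2` keeps the scaled points inside the open balls and later makes `‖φ‖ + δ *
  -- ‖ψ‖` strictly less than `u`.
  have hbd : ∀ a b : W, ‖a‖ ≤ 1 → ‖b‖ ≤ 1 → (1 + η / 2) * (φ a + δ * ψ b) ≤ u := by
    intro a b ha hb
    have := hΦC ((1 + η / 2) • a, ((1 + η / 2) * δ) • b) ⟨?_, ?_⟩
    · rw [hΦ] at this
      simp only [map_smul, smul_eq_mul] at this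
      nlinarith
    · rw [mem_ball_zero_iff, norm_smul, Real.norm_of_nonneg (by positivity)]
      nlinarith
    · rw [mem_ball_zero_iff, norm_smul, Real.norm_of_nonneg (by positivity)]
      have : (1 + η / 2) * δ * ‖b‖ ≤ (1 + η / 2) * δ * 1 := by gcongr
      nlinarith [mul_pos hδ hη]
  have hη' : 0 < 1 + η / 2 := by positivity
  have hsum : ‖φ‖ + δ * ‖ψ‖ ≤ u / (1 + η / 2) := by
    have h1 : ∀ b : W, ‖b‖ ≤ 1 → ‖φ‖ ≤ u / (1 + η / 2) - δ * ψ b := fun b hb =>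
      φ.norm_le_of_forall_apply_le fun a ha => by
        have := hbd a b ha hb
        rw [mul_comm, ← le_div_iff₀ hη'] at this
        linarith
    have h2 : ‖ψ‖ ≤ (u / (1 + η / 2) - ‖φ‖) / δ :=
      ψ.norm_le_of_forall_apply_le fun b hb => by
        rw [le_div_iff₀ hδ]
        linarith [h1 b hb]
    rw [le_div_iff₀ hδ] at h2
    linarith
  have hlt : u / (1 + η / 2) < u := by
    rw [div_lt_iff₀ hη']
    nlinarith
  have h1 : P φ w ≤ ‖P φ‖ := hw _ (hPJ φ)
  have h2 : (φ - P φ) w ≤ ‖φ - P φ‖ * (1 + δ) :=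
    (Real.le_norm_self _).trans (((φ - P φ).le_opNorm w).trans (by gcongr))
  -- As `φ` and `ψ` agree on `J`, their parts complementary to `P` coincide. Hence `φ w ≤ ‖P φ‖ + (1
  -- + δ) * ‖φ - P φ‖ ≤ ‖φ‖ + δ * ‖ψ‖ < u`, against `u ≤ φ w`.
  have h3 : ‖φ - P φ‖ ≤ ‖ψ‖ := by
    rw [hPeq φ ψ hJ]
    linarith [hP ψ, norm_nonneg (P ψ)]
  have h4 : φ w = P φ w + (φ - P φ) w := by simp
  nlinarith [hP φ]

/-- A vector at distance at most `1` from an M-ideal has an approximant at distance at most `1`. -/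
theorem exists_norm_sub_le_one_of_isLProjection [CompleteSpace W] (J : Submodule ℝ W)
    (hJ : IsClosed (J : Set W)) (P : StrongDual ℝ W → StrongDual ℝ W)
    (hP : ∀ φ, ‖P φ‖ + ‖φ - P φ‖ ≤ ‖φ‖) (hPJ : ∀ φ, ∀ j ∈ J, P φ j = 0)
    (hPeq : ∀ φ ψ : StrongDual ℝ W, (∀ j ∈ J, φ j = ψ j) → φ - P φ = ψ - P ψ) (w : W)
    (hw : ∀ φ : StrongDual ℝ W, (∀ j ∈ J, φ j = 0) → φ w ≤ ‖φ‖) :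
    ∃ j ∈ J, ‖w - j‖ ≤ 1 := by
  set D : ℝ := ‖w‖ + 1 with hD
  have hD0 : 0 < D := by positivity
  -- Permitted excess over `1` at stage `n`. Each correction halves it and has norm of order `d n`,
  -- so the corrections are summable; the value `D = ‖w‖ + 1` lets the iteration start at `0`.
  let d : ℕ → ℝ := fun n => D / 2 ^ n
  have hd : ∀ n, 0 < d n := fun n => by positivity
  let S : ℕ → Type _ := fun n => {j : W // j ∈ J ∧ ‖w - j‖ ≤ 1 + d n}
  have step : ∀ n (s : S n), ∃ t : S (n + 1), ‖s.1 - t.1‖ ≤ D * (1 + D) / 2 ^ n := by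
    rintro n ⟨j, hj, hjn⟩
    obtain ⟨i, hi, hi1, hi2⟩ := exists_correction_of_isLProjection J P hP hPJ hPeq (w - j)
      (fun φ hφ => by rw [map_sub, hφ j hj, sub_zero]; exact hw φ hφ) (hd n) (hd (n + 1)) hjn
    refine ⟨⟨j + i, J.add_mem hj hi, ?_⟩, ?_⟩
    · rw [← sub_sub]; exact hi1.le
    · simp only [sub_add_cancel_left, norm_neg]
      have h1 : d (n + 1) ≤ D := div_le_self hD0.le (one_le_pow₀ (by norm_num))
      calc ‖i‖ ≤ d n * (1 + d (n + 1)) := hi2.le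
        _ ≤ d n * (1 + D) := by gcongr
        _ = _ := by simp only [d]; ring
  choose nxt hnxt using step
  let s : ∀ n, S n := fun n => Nat.rec (motive := S) ⟨0, J.zero_mem, by simp [d, hD]; linarith⟩ nxt n
  have hs : ∀ n, ‖(s n).1 - (s (n + 1)).1‖ ≤ D * (1 + D) / 2 ^ n := fun n => hnxt n (s n)
  have hcau : CauchySeq fun n => (s n).1 := by
    refine cauchySeq_of_le_geometric (1 / 2) (D * (1 + D)) (by norm_num) fun n => ?_
    rw [dist_eq_norm]
    refine (hs n).trans_eq ?_
    simp [div_eq_mul_inv]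
  obtain ⟨j, hj⟩ := cauchySeq_tendsto_of_complete hcau
  refine ⟨j, hJ.mem_of_tendsto hj (Eventually.of_forall fun n => (s n).2.1), ?_⟩
  have hd0 : Tendsto (fun n => 1 + d n) atTop (𝓝 (1 + 0)) := by
    refine tendsto_const_nhds.add ?_
    have := (tendsto_pow_atTop_nhds_zero_of_lt_one (r := (1 / 2 : ℝ)) (by norm_num)
      (by norm_num)).const_mul D
    simpa [d, div_eq_mul_inv] using this
  rw [add_zero] at hd0
  exact le_of_tendsto_of_tendsto (tendsto_const_nhds.sub hj).norm hd0
    (Eventually.of_forall fun n => (s n).2.2)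

end MIdeal

/-! ### Contractive lifting of `ℓ^∞(k)` into `Y`. -/

section Lifting

variable {Y : Type*} [NormedAddCommGroup Y] [NormedSpace ℝ Y] {ι : Type*} [Fintype ι]

theorem exists_basis_projection_of_isEll1Summand {E : Type*} [NormedAddCommGroup E]
    [NormedSpace ℝ E] {k : ℕ} {F : Submodule ℝ E} (hF : IsEll1Summand k F) :
    ∃ (f : Fin k → E) (P : E →ₗ[ℝ] E),
      (∀ a : Fin k → ℝ, ‖∑ i, a i • f i‖ = ∑ i, |a i|) ∧
      (∀ g ∈ F, ∃ a : Fin k → ℝ, g = ∑ i, a i • f i) ∧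
      (∀ g, P g ∈ F) ∧ (∀ i, P (f i) = f i) ∧ ∀ g, ‖P g‖ + ‖g - P g‖ ≤ ‖g‖ := by
  obtain ⟨⟨e⟩, N, -, hFN, hnorm⟩ := hF
  let b : Fin k → F := fun i => e.symm (WithLp.toLp 1 (Pi.single i 1))
  have hb : ∀ a : Fin k → ℝ, ∑ i, a i • b i = e.symm (WithLp.toLp 1 a) := fun a => by
    simp only [b, ← map_smul, ← map_sum]
    congr 1
    ext j
    simp [Pi.single_apply]
  have hb' : ∀ a : Fin k → ℝ, ∑ i, a i • (b i : E) = e.symm (WithLp.toLp 1 a) := fun a => by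
    rw [← hb]; simp
  refine ⟨fun i => b i, F.projection N hFN, fun a => ?_, fun g hg => ?_,
    fun g => Submodule.projection_apply_mem hFN g, fun i => Submodule.projection_apply_left hFN (b i),
    fun g => ?_⟩
  · rw [hb', ← Submodule.coe_norm, LinearIsometryEquiv.norm_map, PiLp.norm_eq_of_L1]
    simp
  · refine ⟨WithLp.ofLp (e ⟨g, hg⟩), ?_⟩
    rw [hb']
    simp
  · rw [← hnorm _ (Submodule.projection_apply_mem hFN g) _ ?_]
    · simp
    · rw [← Submodule.projection_apply_eq_zero_iff hFN, map_sub, sub_eq_zero]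
      exact (Submodule.projection_apply_left hFN ⟨_, Submodule.projection_apply_mem hFN g⟩).symm

/-- Linear functionals with the norm of `ℓ¹` take all values. -/
theorem exists_apply_eq_of_norm_sum_eq (f : ι → StrongDual ℝ Y)
    (hf : ∀ a : ι → ℝ, ‖∑ i, a i • f i‖ = ∑ i, |a i|) (a : ι → ℝ) :
    ∃ y : Y, ∀ i, f i y = a i := by
  classical
  let A : Y →ₗ[ℝ] (ι → ℝ) := LinearMap.pi fun i => (f i : Y →ₗ[ℝ] ℝ)
  suffices LinearMap.range A = ⊤ by
    obtain ⟨y, hy⟩ := LinearMap.range_eq_top.1 this a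
    exact ⟨y, fun i => congrFun hy i⟩
  by_contra hne
  obtain ⟨c, hc, hcA⟩ := Submodule.exists_le_ker_of_lt_top _ (lt_top_iff_ne_top.2 hne)
  have hc_apply : ∀ v, c v = ∑ i, c (Pi.single i 1) * v i := fun v => by
    conv_lhs => rw [← Finset.univ_sum_single v]
    rw [map_sum]
    refine Finset.sum_congr rfl fun i _ => ?_
    rw [mul_comm, ← smul_eq_mul, ← map_smul, ← Pi.single_smul, smul_eq_mul, mul_one]
  -- A functional `c` killing the range of `A` is a linear relation among the `f i`, which the norm
  -- formula forbids.
  have hz : ∑ i, c (Pi.single i 1) • f i = 0 := by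
    ext y
    have : c (A y) = 0 := hcA ⟨y, rfl⟩
    rw [hc_apply] at this
    simpa [A] using this
  have h0 := hf fun i => c (Pi.single i 1)
  rw [hz, norm_zero, eq_comm, Finset.sum_eq_zero_iff_of_nonneg fun _ _ => abs_nonneg _] at h0
  refine hc (LinearMap.ext fun v => ?_)
  rw [hc_apply]
  exact Finset.sum_eq_zero fun i hi => by rw [abs_eq_zero.1 (h0 i hi), zero_mul]

/-- A sign vector as a vector of the unit ball of `ℓ^∞`. -/
def signVec (ε : ι → SignType) : ι → ℝ := fun i => (ε i : ℝ)

theorem norm_signVec_le (ε : ι → SignType) : ‖signVec ε‖ ≤ 1 := by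
  refine (pi_norm_le_iff_of_nonneg zero_le_one).2 fun i => ?_
  unfold signVec
  rcases ε i <;> simp

variable [DecidableEq ι] in
theorem ContinuousLinearMap.apply_eq_sum_single (T : (ι → ℝ) →L[ℝ] Y)
    (a : ι → ℝ) : T a = ∑ i, a i • T (Pi.single i 1) := by
  conv_lhs => rw [← Finset.univ_sum_single a]
  rw [map_sum]
  refine Finset.sum_congr rfl fun i _ => ?_
  rw [← map_smul, ← Pi.single_smul, smul_eq_mul, mul_one]

/-- For each `g` in the dual, `g (T a)` is linear in `a`, so on the unit ball of `ℓ^∞` it is largest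
at the signs of its coefficients `g (T eᵢ)`. -/
theorem opNorm_le_of_signVec (T : (ι → ℝ) →L[ℝ] Y) {c : ℝ} (hc : 0 ≤ c)
    (h : ∀ ε : ι → SignType, ‖T (signVec ε)‖ ≤ c) : ‖T‖ ≤ c := by
  classical
  refine T.opNorm_le_of_unit_norm hc fun a ha => ?_
  refine NormedSpace.norm_le_dual_bound ℝ _ hc fun g => ?_
  set ε : ι → SignType := fun i => SignType.sign (g (T (Pi.single i 1))) with hε
  have h1 : ∀ b : ι → ℝ, g (T b) = ∑ i, b i * g (T (Pi.single i 1)) := fun b => by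
    rw [T.apply_eq_sum_single b]; simp
  calc ‖g (T a)‖ ≤ ∑ i, ‖a i * g (T (Pi.single i 1))‖ := by rw [h1]; exact norm_sum_le _ _
    _ ≤ ∑ i, signVec ε i * g (T (Pi.single i 1)) := by
        refine Finset.sum_le_sum fun i _ => ?_
        rw [norm_mul, signVec, hε, mul_comm (SignType.cast _), self_mul_sign, Real.norm_eq_abs (g _)]
        exact mul_le_of_le_one_left (abs_nonneg _) ((norm_le_pi_norm a i).trans ha.le)
    _ = g (T (signVec ε)) := (h1 _).symm
    _ ≤ ‖g‖ * ‖T (signVec ε)‖ := (Real.le_norm_self _).trans (g.le_opNorm _)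
    _ ≤ ‖g‖ * c := by gcongr; exact h ε
    _ = c * ‖g‖ := mul_comm _ _

/-- A functional on a finite product with the sup norm: the norms of its components sum up to at
most its norm. -/
theorem sum_norm_comp_single_le {κ : Type*} [Fintype κ] [DecidableEq κ]
    (Φ : StrongDual ℝ (κ → Y)) :
    ∑ i, ‖Φ.comp (ContinuousLinearMap.single ℝ (fun _ : κ => Y) i)‖ ≤ ‖Φ‖ := by
  set h := fun i => Φ.comp (ContinuousLinearMap.single ℝ (fun _ : κ => Y) i) with hh
  have hsum : ∀ y : κ → Y, Φ y = ∑ i, h i (y i) := fun y => by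
    conv_lhs => rw [← Finset.univ_sum_single y]
    simp [hh]
  refine le_of_forall_pos_le_add fun δ hδ => ?_
  -- Almost norming vectors for the components assemble into one vector of sup norm at most `1`; the
  -- `+ 1` covers an empty index set.
  set d : ℝ := δ / (Fintype.card κ + 1) with hd
  have hd0 : 0 < d := by positivity
  have hex : ∀ i, ∃ y : Y, ‖y‖ ≤ 1 ∧ ‖h i‖ - d ≤ h i y := fun i => by
    by_contra! hcon
    linarith [StrongDual.norm_le_of_forall_apply_le (h i) fun y hy => (hcon y hy).le]
  choose y hy1 hy2 using hex
  have h1 : ∑ i, (‖h i‖ - d) ≤ ‖Φ‖ := by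
    calc ∑ i, (‖h i‖ - d) ≤ Φ y := by
          rw [hsum]; exact Finset.sum_le_sum fun i _ => hy2 i
      _ ≤ ‖Φ y‖ := Real.le_norm_self _
      _ ≤ ‖Φ‖ := Φ.unit_le_opNorm y ((pi_norm_le_iff_of_nonneg zero_le_one).2 hy1)
  rw [Finset.sum_sub_distrib, Finset.sum_const, Finset.card_univ, nsmul_eq_mul] at h1
  have h2 : (Fintype.card κ : ℝ) * d ≤ δ := by
    rw [hd, mul_div_assoc', div_le_iff₀ (by positivity)]
    nlinarith
  linarith

variable [DecidableEq ι]

/-- Functionals on operators from `ℓ^∞` are sums of evaluations at sign vectors. -/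
theorem exists_signVec_representation (φ : StrongDual ℝ ((ι → ℝ) →L[ℝ] Y)) :
    ∃ h : (ι → SignType) → StrongDual ℝ Y, ∑ ε, ‖h ε‖ ≤ ‖φ‖ ∧
      ∀ T, φ T = ∑ ε, h ε (T (signVec ε)) := by
  -- Evaluation at the sign vectors embeds the operators isometrically into a finite sup-sum of
  -- copies of `Y`; a Hahn–Banach extension to that sum then splits into components.
  let j : ((ι → ℝ) →L[ℝ] Y) →ₗᵢ[ℝ] ((ι → SignType) → Y) :=
    { toLinearMap := LinearMap.pi fun ε =>
        ((ContinuousLinearMap.apply ℝ Y (signVec ε) : _ →L[ℝ] Y) : _ →ₗ[ℝ] Y)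
      norm_map' := fun T => by
        refine le_antisymm ?_ ?_
        · refine (pi_norm_le_iff_of_nonneg (norm_nonneg _)).2 fun ε => ?_
          exact T.unit_le_opNorm _ (norm_signVec_le ε)
        · exact opNorm_le_of_signVec T (norm_nonneg _) fun ε => norm_le_pi_norm (fun ε => T (signVec ε)) ε }
  let e := j.equivRange
  obtain ⟨Φ, hΦ, hΦn⟩ := exists_extension_norm_eq (LinearMap.range j.toLinearMap)
    (φ.comp (e.symm.toContinuousLinearEquiv : _ →L[ℝ] ((ι → ℝ) →L[ℝ] Y)))
  refine ⟨fun ε => Φ.comp (ContinuousLinearMap.single ℝ (fun _ => Y) ε), ?_, fun T => ?_⟩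
  · refine (sum_norm_comp_single_le Φ).trans ?_
    rw [hΦn]
    refine ContinuousLinearMap.opNorm_le_bound _ (norm_nonneg φ) fun x => ?_
    refine (φ.le_opNorm _).trans_eq ?_
    congr 1
    exact e.symm.norm_map x
  · have h1 := hΦ (e T)
    have h2 : Φ (j T) = φ T :=
      h1.trans (congrArg φ (e.symm_apply_apply T))
    rw [← h2]
    conv_lhs => rw [← Finset.univ_sum_single (j T)]
    simp only [map_sum]
    rfl

/-- If `f` spans an L-summand isometric to `ℓ¹` in `Y*`, then the quotient map
`y ↦ (fᵢ y)ᵢ` has a contractive linear right inverse. -/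
theorem exists_contractive_lift [CompleteSpace Y] (f : ι → StrongDual ℝ Y)
    (P : StrongDual ℝ Y →ₗ[ℝ] StrongDual ℝ Y)
    (hf : ∀ a : ι → ℝ, ‖∑ i, a i • f i‖ = ∑ i, |a i|)
    (hPf : ∀ i, P (f i) = f i) (hPmem : ∀ g, ∃ a : ι → ℝ, P g = ∑ i, a i • f i)
    (hP : ∀ g, ‖P g‖ + ‖g - P g‖ ≤ ‖g‖) :
    ∃ L : (ι → ℝ) →L[ℝ] Y, ‖L‖ ≤ 1 ∧ ∀ a i, f i (L a) = a i := by
  let ev (a : ι → ℝ) : ((ι → ℝ) →L[ℝ] Y) →L[ℝ] Y := ContinuousLinearMap.apply ℝ Y a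
  let coord (φ : StrongDual ℝ ((ι → ℝ) →L[ℝ] Y)) (j : ι) : StrongDual ℝ Y :=
    φ.comp (ContinuousLinearMap.smulRightL ℝ (ι → ℝ) Y (ContinuousLinearMap.proj j))
  -- `Q` applies `P` to the `Y*`-coefficients of `φ`. By `hrep` it acts the same way on any
  -- sign-vector representation, which is how the L-projection inequality passes from `P` to `Q`.
  let Q (φ : StrongDual ℝ ((ι → ℝ) →L[ℝ] Y)) : StrongDual ℝ ((ι → ℝ) →L[ℝ] Y) :=
    ∑ j, (P (coord φ j)).comp (ev (Pi.single j 1))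
  have hQsub : ∀ φ ψ, Q (φ - ψ) = Q φ - Q ψ := fun φ ψ => by
    ext1 T
    simp only [Q, sum_apply, sub_apply, ContinuousLinearMap.comp_apply]
    rw [← Finset.sum_sub_distrib]
    refine Finset.sum_congr rfl fun j _ => ?_
    have : coord (φ - ψ) j = coord φ j - coord ψ j := rfl
    rw [this, map_sub]
    rfl
  have hcoord : ∀ φ T, φ T = ∑ j, coord φ j (T (Pi.single j 1)) := fun φ T => by
    have : T = ∑ j, ContinuousLinearMap.smulRightL ℝ (ι → ℝ) Y (ContinuousLinearMap.proj j)
        (T (Pi.single j 1)) := by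
      ext1 a
      rw [T.apply_eq_sum_single a]
      simp
    conv_lhs => rw [this]
    rw [map_sum]
    rfl
  have hrep : ∀ (φ) (h : (ι → SignType) → StrongDual ℝ Y),
      (∀ T, φ T = ∑ ε, h ε (T (signVec ε))) → ∀ T, Q φ T = ∑ ε, P (h ε) (T (signVec ε)) := by
    intro φ h hφ T
    have h1 : ∀ j, coord φ j = ∑ ε, signVec ε j • h ε := fun j => by
      ext y
      simp [coord, hφ]
    calc Q φ T = ∑ j, ∑ ε, signVec ε j * P (h ε) (T (Pi.single j 1)) := by
          simp [Q, ev, h1]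
      _ = ∑ ε, ∑ j, signVec ε j * P (h ε) (T (Pi.single j 1)) := Finset.sum_comm
      _ = _ := by
          refine Finset.sum_congr rfl fun ε _ => ?_
          rw [T.apply_eq_sum_single (signVec ε)]
          simp
  have hsum_le : ∀ (ψ : StrongDual ℝ ((ι → ℝ) →L[ℝ] Y)) (h : (ι → SignType) → StrongDual ℝ Y),
      (∀ T, ψ T = ∑ ε, h ε (T (signVec ε))) → ‖ψ‖ ≤ ∑ ε, ‖h ε‖ := by
    intro ψ h hψ
    refine ψ.opNorm_le_bound (by positivity) fun T => ?_
    rw [hψ, Finset.sum_mul]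
    refine (norm_sum_le _ _).trans (Finset.sum_le_sum fun ε _ => ?_)
    exact ((h ε).le_opNorm _).trans (by gcongr; exact T.unit_le_opNorm _ (norm_signVec_le ε))
  have hQ : ∀ φ, ‖Q φ‖ + ‖φ - Q φ‖ ≤ ‖φ‖ := by
    intro φ
    obtain ⟨h, hle, hφ⟩ := exists_signVec_representation φ
    have h1 := hsum_le (Q φ) _ (hrep φ h hφ)
    have h2 := hsum_le (φ - Q φ) (fun ε => h ε - P (h ε)) fun T => by
      simp [hφ T, hrep φ h hφ T]
    have h3 : ∑ ε, (‖P (h ε)‖ + ‖h ε - P (h ε)‖) ≤ ∑ ε, ‖h ε‖ :=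
      Finset.sum_le_sum fun ε _ => hP _
    rw [Finset.sum_add_distrib] at h3
    linarith
  let J : Submodule ℝ ((ι → ℝ) →L[ℝ] Y) :=
    ⨅ a : ι → ℝ, ⨅ i, LinearMap.ker ((f i).comp (ev a) : _ →ₗ[ℝ] ℝ)
  have hJmem : ∀ T, T ∈ J ↔ ∀ a i, f i (T a) = 0 := fun T => by
    simp [J, ev, Submodule.mem_iInf]
  have hJ : IsClosed (J : Set ((ι → ℝ) →L[ℝ] Y)) := by
    have : (J : Set ((ι → ℝ) →L[ℝ] Y)) = ⋂ a, ⋂ i, {T | ((f i).comp (ev a)) T = 0} := by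
      ext T
      simp [hJmem, ev]
    rw [this]
    exact isClosed_iInter fun a => isClosed_iInter fun i =>
      isClosed_eq ((f i).comp (ev a)).continuous continuous_const
  have hQJ : ∀ φ, ∀ T ∈ J, Q φ T = 0 := by
    intro φ T hT
    rw [hJmem] at hT
    simp only [Q, ev, sum_apply, ContinuousLinearMap.comp_apply,
      ContinuousLinearMap.apply_apply]
    refine Finset.sum_eq_zero fun j _ => ?_
    obtain ⟨a, ha⟩ := hPmem (coord φ j)
    rw [ha]
    simp [hT]
  have hQid : ∀ φ : StrongDual ℝ ((ι → ℝ) →L[ℝ] Y), (∀ T ∈ J, φ T = 0) → Q φ = φ := by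
    intro φ hφ
    ext1 T
    rw [hcoord φ T]
    simp only [Q, ev, sum_apply, ContinuousLinearMap.comp_apply,
      ContinuousLinearMap.apply_apply]
    refine Finset.sum_congr rfl fun j _ => ?_
    -- If all `f i` vanish at `y`, the rank-one operator `a ↦ a j • y` lies in `J`; so each
    -- coefficient of `φ ∈ J^⊥` lies in the span of the `f i`, where `P` is the identity.
    have hker : ⨅ i, LinearMap.ker (f i : Y →ₗ[ℝ] ℝ) ≤ LinearMap.ker (coord φ j : Y →ₗ[ℝ] ℝ) := by
      intro y hy
      simp only [Submodule.mem_iInf, LinearMap.mem_ker, ContinuousLinearMap.coe_coe] at hy ⊢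
      refine hφ _ ((hJmem _).2 fun a i => ?_)
      simp [hy i]
    have hspan := mem_span_of_iInf_ker_le_ker hker
    rw [Submodule.mem_span_range_iff_exists_fun] at hspan
    obtain ⟨c, hc⟩ := hspan
    have : coord φ j = ∑ i, c i • f i := by
      ext y
      have := LinearMap.congr_fun hc y
      simpa [sum_apply, LinearMap.sum_apply] using this.symm
    rw [this]
    simp [hPf]
  choose y hy using fun j => exists_apply_eq_of_norm_sum_eq f hf (Pi.single j 1)
  let T₀ : (ι → ℝ) →L[ℝ] Y :=
    ∑ j, ContinuousLinearMap.smulRightL ℝ (ι → ℝ) Y (ContinuousLinearMap.proj j) (y j)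
  have hT₀ : ∀ a i, f i (T₀ a) = a i := fun a i => by
    simp [T₀, hy, Pi.single_apply]
  -- On `J^⊥` the lift `T₀` is a functional of norm at most `1`: writing `P (h ε) = ∑ aᵢ fᵢ`, its
  -- value at `T₀ (signVec ε)` is `∑ aᵢ εᵢ ≤ ∑ |aᵢ| = ‖P (h ε)‖`.
  have hT₀J : ∀ φ : StrongDual ℝ ((ι → ℝ) →L[ℝ] Y), (∀ T ∈ J, φ T = 0) → φ T₀ ≤ ‖φ‖ := by
    intro φ hφ
    obtain ⟨h, hle, hrepφ⟩ := exists_signVec_representation φ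
    rw [← hQid φ hφ, hrep φ h hrepφ, hQid φ hφ]
    refine le_trans (Finset.sum_le_sum fun ε _ => ?_) hle
    refine le_trans ?_ ((le_add_of_nonneg_right (norm_nonneg _)).trans (hP (h ε)))
    obtain ⟨a, ha⟩ := hPmem (h ε)
    rw [ha, hf]
    simp only [sum_apply, smul_apply, hT₀, smul_eq_mul]
    refine Finset.sum_le_sum fun i _ => ?_
    refine (le_abs_self _).trans ?_
    rw [abs_mul]
    exact mul_le_of_le_one_right (abs_nonneg _) ((norm_le_pi_norm _ i).trans (norm_signVec_le ε))
  obtain ⟨S, hS, hle⟩ := exists_norm_sub_le_one_of_isLProjection J hJ Q hQ hQJ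
    (fun φ ψ h => by
      have := hQid (φ - ψ) fun T hT => by simp [h T hT]
      rw [hQsub] at this
      rw [sub_eq_sub_iff_sub_eq_sub, this]) T₀ hT₀J
  refine ⟨T₀ - S, hle, fun a i => ?_⟩
  rw [sub_apply, map_sub, hT₀, (hJmem S).1 hS, sub_zero]

end Lifting

/-! ### Proximinality of `K(X, Z)` from the lift. -/

section Proximinal

variable {X : Type*} [NormedAddCommGroup X] [NormedSpace ℝ X]
  {Y : Type*} [NormedAddCommGroup Y] [NormedSpace ℝ Y]

/-- Pointwise ultrafilter limits of bounded sequences of operators into a finite-dimensional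
space. -/
theorem exists_operator_limit {V : Type*} [NormedAddCommGroup V] [NormedSpace ℝ V]
    [FiniteDimensional ℝ V] (R : ℕ → X →L[ℝ] V) {C : ℝ} (hC : ∀ n, ‖R n‖ ≤ C) :
    ∃ S : X →L[ℝ] V, ∀ x, Tendsto (fun n => R n x) (hyperfilter ℕ : Filter ℕ) (𝓝 (S x)) := by
  have hlim : ∀ x, ∃ v, Tendsto (fun n => R n x) (hyperfilter ℕ : Filter ℕ) (𝓝 v) := fun x => by
    have hK : IsCompact (Metric.closedBall (0 : V) (C * ‖x‖)) :=
      haveI := FiniteDimensional.proper ℝ V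
      isCompact_closedBall _ _
    obtain ⟨v, -, hv⟩ := hK.ultrafilter_le_nhds ((hyperfilter ℕ).map fun n => R n x) <| by
      rw [Ultrafilter.coe_map, le_principal_iff, mem_map]
      exact Eventually.of_forall fun n => by
        simpa using ((R n).le_opNorm x).trans (by gcongr; exact hC n)
    exact ⟨v, hv⟩
  choose S hS using hlim
  refine ⟨LinearMap.mkContinuous ⟨⟨S, fun x y => ?_⟩, fun c x => ?_⟩ C fun x => ?_, hS⟩
  · refine tendsto_nhds_unique (hS (x + y)) ?_
    simpa using (hS x).add (hS y)
  · refine tendsto_nhds_unique (hS (c • x)) ?_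
    simpa using (hS x).const_smul c
  · refine le_of_tendsto (hS x).norm (Eventually.of_forall fun n => ?_)
    exact ((R n).le_opNorm x).trans (by gcongr; exact hC n)

theorem isClosed_compactOpsInto {Z : Submodule ℝ Y} (hZ : IsClosed (Z : Set Y)) :
    IsClosed (compactOpsInto X Z : Set (CompactOps X Y)) := by
  have : (compactOpsInto X Z : Set (CompactOps X Y)) =
      ⋂ x : X, {T : CompactOps X Y | (T : X →L[ℝ] Y) x ∈ Z} := by
    ext T
    simp [compactOpsInto]
  rw [this]
  exact isClosed_iInter fun x => hZ.preimage
    ((ContinuousLinearMap.apply ℝ Y x).continuous.comp continuous_subtype_val)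

/-- If `Z` contains the kernel of a contraction onto `ℓ^∞` with a contractive right inverse,
then `K(X, Z)` is proximinal. -/
theorem isProximinal_compactOpsInto_of_lift {ι : Type*} [Fintype ι] {Z : Submodule ℝ Y}
    (hZ : IsClosed (Z : Set Y)) (A : Y →L[ℝ] (ι → ℝ)) (hA : ‖A‖ ≤ 1)
    (L : (ι → ℝ) →L[ℝ] Y) (hL : ‖L‖ ≤ 1) (hAL : ∀ a, A (L a) = a)
    (hker : ∀ y, A y = 0 → y ∈ Z) : IsProximinal (E := CompactOps X Y) (compactOpsInto X Z) := by
  refine ⟨isClosed_compactOpsInto hZ, fun T => ?_⟩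
  set J : Submodule ℝ (CompactOps X Y) := compactOpsInto X Z with hJ
  set d := Metric.infDist T (J : Set (CompactOps X Y)) with hd
  have hne : (J : Set (CompactOps X Y)).Nonempty := ⟨0, J.zero_mem⟩
  have hex : ∀ n : ℕ, ∃ S ∈ J, ‖T - S‖ < d + 1 / (n + 1) := fun n => by
    obtain ⟨S, hS, hlt⟩ := (Metric.infDist_lt_iff hne).1
      (lt_add_of_pos_right d (Nat.one_div_pos_of_nat (α := ℝ) (n := n)))
    exact ⟨S, hS, (dist_eq_norm T S).symm.trans_lt hlt⟩
  choose S hSJ hSd using hex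
  let B (U : CompactOps X Y) : X →L[ℝ] (ι → ℝ) := A.comp (U : X →L[ℝ] Y)
  have hB : ∀ U, ‖B U‖ ≤ ‖U‖ := fun U =>
    (A.opNorm_comp_le _).trans (mul_le_of_le_one_left (norm_nonneg _) hA)
  obtain ⟨R, hR⟩ := exists_operator_limit (fun n => B (S n)) (C := ‖T‖ + (d + 1)) fun n => by
    refine (hB _).trans ?_
    have h1 : ‖S n‖ ≤ ‖T‖ + ‖T - S n‖ := by
      simpa using norm_sub_le T (T - S n)
    have h2 : (1 : ℝ) / (n + 1) ≤ 1 := by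
      rw [div_le_one (by positivity)]
      linarith [(Nat.cast_nonneg n : (0 : ℝ) ≤ n)]
    linarith [hSd n]
  -- The image `A(Z)` is closed because it is finite-dimensional, so it contains the limit `R x`.
  have hRmem : ∀ x, R x ∈ Z.map (A : Y →ₗ[ℝ] (ι → ℝ)) := fun x => by
    have hcl : IsClosed (Z.map (A : Y →ₗ[ℝ] (ι → ℝ)) : Set (ι → ℝ)) :=
      Submodule.closed_of_finiteDimensional _
    exact hcl.mem_of_tendsto (hR x)
      (Eventually.of_forall fun n => ⟨(S n : X →L[ℝ] Y) x, hSJ n x, rfl⟩)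
  have hnorm : ‖B T - R‖ ≤ d := by
    refine ContinuousLinearMap.opNorm_le_bound _ Metric.infDist_nonneg fun x => ?_
    have hlim : Tendsto (fun n : ℕ => (d + 1 / ((n : ℝ) + 1)) * ‖x‖) (hyperfilter ℕ : Filter ℕ)
        (𝓝 (d * ‖x‖)) := by
      have := ((tendsto_const_nhds (x := d)).add
        (tendsto_one_div_add_atTop_nhds_zero_nat (𝕜 := ℝ))).mul_const ‖x‖
      rw [add_zero] at this
      exact this.mono_left Nat.hyperfilter_le_atTop
    refine le_of_tendsto_of_tendsto (tendsto_const_nhds.sub (hR x)).norm hlim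
      (Eventually.of_forall fun n => ?_)
    have : B T x - B (S n) x = B (T - S n) x := by simp [B]
    change ‖B T x - B (S n) x‖ ≤ _
    rw [this]
    exact ((B _).le_opNorm x).trans
      (mul_le_mul_of_nonneg_right ((hB _).trans (hSd n).le) (norm_nonneg x))
  have hcomp : IsCompactOperator (L.comp (B T - R)) :=
    (isCompactOperator_of_locallyCompactSpace_dom (B T - R)).clm_comp L
  let K : CompactOps X Y := ⟨L.comp (B T - R), hcomp⟩
  -- Since `A ∘ (T - K) = R`, each value of `T - K` differs from an element of `Z` by an element of
  -- `ker A ⊆ Z`.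
  have hmem : T - K ∈ J := fun x => by
    obtain ⟨z, hz, hzx⟩ := hRmem x
    have : (T - K : X →L[ℝ] Y) x - z ∈ Z := by
      refine hker _ ?_
      have hzx' : A z = R x := hzx
      simp [K, B, hAL, hzx']
    simpa using Z.add_mem this hz
  refine ⟨T - K, hmem, le_antisymm ?_ ?_⟩
  · exact (Metric.infDist_le_dist_of_mem hmem).trans_eq (dist_eq_norm T (T - K))
  · rw [sub_sub_cancel]
    exact (L.opNorm_comp_le _).trans
      ((mul_le_of_le_one_left (norm_nonneg _) hL).trans hnorm)

/-- `K(X, Z)` is proximinal in `K(X, Y)` if `Z` has finite codimension and its annihilator lies in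
an L-summand of `Y*` isometric to `ℓ¹(k)`. -/
theorem isProximinal_compactOpsInto_of_isEll1Summand [CompleteSpace Y] {Z : Submodule ℝ Y}
    (hZ : IsClosed (Z : Set Y)) {k : ℕ} {F : Submodule ℝ (StrongDual ℝ Y)}
    (hF : IsEll1Summand k F) (hZF : StrongDual.polarSubmodule ℝ Z ≤ F) :
    IsProximinal (E := CompactOps X Y) (compactOpsInto X Z) := by
  obtain ⟨f, P, hf, hspan, hPF, hPf, hP⟩ := exists_basis_projection_of_isEll1Summand hF
  obtain ⟨L, hL, hfL⟩ := exists_contractive_lift f P hf hPf (fun g => hspan _ (hPF g)) hP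
  refine isProximinal_compactOpsInto_of_lift hZ (ContinuousLinearMap.pi f) ?_ L hL
    (fun a => funext fun i => hfL a i) fun y hy => ?_
  · refine ContinuousLinearMap.opNorm_le_bound _ zero_le_one fun y => ?_
    rw [one_mul]
    refine (pi_norm_le_iff_of_nonneg (norm_nonneg _)).2 fun i => ?_
    have h1 : ‖f i‖ = 1 := by
      have := hf (Pi.single i 1)
      simpa [Pi.single_apply, apply_ite] using this
    simpa [h1] using (f i).le_opNorm y
  · by_contra hyZ
    obtain ⟨g, u, hgu, hu⟩ := geometric_hahn_banach_closed_point Z.convex hZ hyZ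
    have hgZ : ∀ z ∈ Z, g z = 0 := fun z hz => by
      by_contra hne
      have := hgu _ (Z.smul_mem (u / g z) hz)
      rw [map_smul, smul_eq_mul, div_mul_cancel₀ _ hne] at this
      exact lt_irrefl _ this
    obtain ⟨a, ha⟩ := hspan g (hZF ((StrongDual.mem_polarSubmodule ℝ Z g).2 hgZ))
    have h0 : g y = 0 := by
      rw [ha]
      have : ∀ i, f i y = 0 := fun i => congrFun hy i
      simp [this]
    have := hgu 0 Z.zero_mem
    rw [map_zero] at this
    linarith

end Proximinal

/-! ### Strong proximinality excludes small L-splittings of functionals in `Z^⊥`. -/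

section StrongProximinality

variable {Y : Type*} [NormedAddCommGroup Y] [NormedSpace ℝ Y]

/-- A functional vanishing on a strongly proximinal subspace of finite codimension almost attains
its norm only near points where it attains it. -/
theorem IsStronglyProximinal.exists_subseq_norm_attaining {Z : Submodule ℝ Y}
    (hZ : IsStronglyProximinal Z) (hfin : FiniteDimensional ℝ (Y ⧸ Z)) {f : StrongDual ℝ Y}
    (hf : ∀ z ∈ Z, f z = 0) (hf0 : f ≠ 0) {y : ℕ → Y} (hy : ∀ n, ‖y n‖ ≤ 1)
    (hfy : Tendsto (fun n => f (y n)) atTop (𝓝 ‖f‖)) :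
    ∃ φ : ℕ → ℕ, ∃ u : ℕ → Y, (∀ j, ‖u j‖ ≤ 1 ∧ f (u j) = ‖f‖) ∧
      Tendsto (fun j => ‖y (φ j) - u j‖) atTop (𝓝 0) := by
  have hfpos : 0 < ‖f‖ := norm_pos_iff.2 hf0
  obtain ⟨C, hC⟩ := Z.exists_isCompl
  have : FiniteDimensional ℝ C := (Z.quotientEquivOfIsCompl C hC).finiteDimensional
  have hT := (Submodule.IsCompl.isTopCompl_of_finiteDimensional_quotient hC hZ.1.1).symm
  let p : Y →L[ℝ] C := C.projectionOntoL Z hT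
  have hpZ : ∀ x, (p x : Y) - x ∈ Z := fun x => by
    -- `p` is the projection along `Z` onto a finite-dimensional complement, so modulo `Z` the
    -- bounded sequence `y` has a convergent subsequence, with limit `w`.
    rw [← Submodule.projectionOntoL_apply_eq_zero_iff hT, map_sub,
      Submodule.projectionOntoL_apply_left, sub_self]
  obtain ⟨w, -, φ, hφ, hw⟩ := tendsto_subseq_of_bounded
    (x := fun n => p (y n)) (s := Metric.closedBall 0 ‖p‖) Metric.isBounded_closedBall fun n => by
      simpa using (p.le_opNorm (y n)).trans (mul_le_of_le_one_right (norm_nonneg _) (hy n))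
  have hw' : Tendsto (fun j => (p (y (φ j)) : Y)) atTop (𝓝 (w : Y)) :=
    (continuous_subtype_val.tendsto w).comp hw
  have hfw : f w = ‖f‖ := by
    refine tendsto_nhds_unique ((f.continuous.tendsto _).comp hw') ?_
    refine (hfy.comp hφ.tendsto_atTop).congr fun j => ?_
    have := hf _ (hpZ (y (φ j)))
    rw [map_sub, sub_eq_zero] at this
    exact this.symm
  have hge : ∀ z ∈ Z, 1 ≤ ‖(w : Y) - z‖ := fun z hz => by
    have h1 : ‖f‖ ≤ ‖f‖ * ‖(w : Y) - z‖ := by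
      calc ‖f‖ = f (w - z) := by rw [map_sub, hf z hz, sub_zero, hfw]
        _ ≤ _ := (Real.le_norm_self _).trans (f.le_opNorm _)
    exact le_of_mul_le_mul_left (by simpa using h1) hfpos
  -- The `z j` are a minimising sequence for `w`: `w - z j` differs from `y (φ j)` by a null
  -- sequence, while `f w = ‖f‖` forces `d(w, Z) ≥ 1`.
  let z : ℕ → Y := fun j => p (y (φ j)) - y (φ j)
  have hup : ∀ j, ‖(w : Y) - z j‖ ≤ 1 + ‖(w : Y) - p (y (φ j))‖ := fun j => by
    have : (w : Y) - z j = y (φ j) + (w - p (y (φ j))) := by simp only [z]; abel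
    rw [this]
    exact (norm_add_le _ _).trans (by gcongr; exact hy _)
  have hlim0 : Tendsto (fun j => ‖(w : Y) - p (y (φ j))‖) atTop (𝓝 0) := by
    simpa using (tendsto_const_nhds (x := (w : Y))).sub hw' |>.norm
  have hlim : Tendsto (fun j => ‖(w : Y) - z j‖) atTop (𝓝 1) := by
    refine tendsto_of_tendsto_of_tendsto_of_le_of_le tendsto_const_nhds
      (h := fun j => 1 + ‖(w : Y) - p (y (φ j))‖) ?_ (fun j => hge _ (hpZ _)) hup
    simpa using hlim0.const_add 1
  have hdist : Metric.infDist (w : Y) (Z : Set Y) = 1 := by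
    refine le_antisymm ?_ ?_
    · refine ge_of_tendsto hlim (Eventually.of_forall fun j => ?_)
      rw [← dist_eq_norm]
      exact Metric.infDist_le_dist_of_mem (hpZ _)
    · rw [Metric.le_infDist ⟨0, Z.zero_mem⟩]
      intro z hz
      rw [dist_eq_norm]
      exact hge z hz
  obtain ⟨θ, hθ, b, hb, hbz⟩ := hZ.2 w z (fun j => hpZ _) (by rwa [hdist])
  refine ⟨φ ∘ θ, fun j => w - b j, fun j => ⟨?_, ?_⟩, ?_⟩
  · rw [← (hb j).2, hdist]
  · rw [map_sub, hf _ (hb j).1, sub_zero, hfw]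
  · have h1 := hbz.add (hlim0.comp hθ.tendsto_atTop)
    rw [add_zero] at h1
    refine squeeze_zero (fun _ => norm_nonneg _) (fun j => ?_) h1
    have : y (φ (θ j)) - (w - b j) = -((z (θ j) - b j) + (w - p (y (φ (θ j))))) := by
      simp only [z]; abel
    simp only [Function.comp_apply]
    rw [this, norm_neg]
    exact norm_add_le _ _

/-- A functional vanishing on a strongly proximinal subspace of finite codimension has no small
L-summands. -/
theorem IsStronglyProximinal.exists_le_norm_of_split {Z : Submodule ℝ Y}
    (hZ : IsStronglyProximinal Z) (hfin : FiniteDimensional ℝ (Y ⧸ Z)) {f : StrongDual ℝ Y}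
    (hf : ∀ z ∈ Z, f z = 0) :
    ∃ ε > 0, ∀ g : StrongDual ℝ Y, ‖f - g‖ + ‖g‖ = ‖f‖ → ‖f - g - g‖ = ‖f‖ →
      g = 0 ∨ ε ≤ ‖g‖ := by
  rcases eq_or_ne f 0 with rfl | hf0
  · refine ⟨1, one_pos, fun g hg _ => Or.inl ?_⟩
    rw [zero_sub, norm_neg, norm_zero] at hg
    exact norm_eq_zero.1 (by linarith [norm_nonneg g])
  by_contra! hcon
  choose g hg1 hg2 hg0 hgε using fun n : ℕ => hcon (1 / ((n : ℝ) + 1)) Nat.one_div_pos_of_nat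
  have hgpos : ∀ n, 0 < ‖g n‖ := fun n => norm_pos_iff.2 (hg0 n)
  -- With `y n` almost norming `f - 2 g n`, one gets `g n (y n) < -‖g n‖ / 2`, whereas any `u` in
  -- the unit ball with `f u = ‖f‖` has `g n u ≥ ‖g n‖`. So `y n` stays `3 / 2` away from all such
  -- `u`, although `f (y n) → ‖f‖`.
  have hex : ∀ n, ∃ y : Y, ‖y‖ ≤ 1 ∧ ‖f‖ - ‖g n‖ / 2 < (f - g n - g n) y := fun n => by
    by_contra! h
    have := StrongDual.norm_le_of_forall_apply_le _ h
    rw [hg2] at this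
    linarith [hgpos n]
  choose y hy hhy using hex
  have hsub : ∀ n, ∀ v : Y, ‖v‖ ≤ 1 → f v - g n v ≤ ‖f‖ - ‖g n‖ := fun n v hv => by
    have : (f - g n) v ≤ ‖f - g n‖ := (Real.le_norm_self _).trans ((f - g n).unit_le_opNorm v hv)
    rw [sub_apply] at this
    linarith [hg1 n]
  have hhy' : ∀ n, ‖f‖ - ‖g n‖ / 2 < f (y n) - g n (y n) - g n (y n) := hhy
  have hgy : ∀ n, g n (y n) < -(‖g n‖ / 2) := fun n => by
    linarith [hsub n (y n) (hy n), hhy' n]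
  have hglim : Tendsto (fun n => ‖g n‖) atTop (𝓝 0) :=
    squeeze_zero (fun n => norm_nonneg _) (fun n => (hgε n).le)
      tendsto_one_div_add_atTop_nhds_zero_nat
  have hfy : Tendsto (fun n => f (y n)) atTop (𝓝 ‖f‖) := by
    refine tendsto_of_tendsto_of_tendsto_of_le_of_le (g := fun n => ‖f‖ - 3 * ‖g n‖) ?_
      tendsto_const_nhds (fun n => ?_)
      (fun n => (Real.le_norm_self _).trans (f.unit_le_opNorm _ (hy n)))
    · simpa using (hglim.const_mul 3).const_sub ‖f‖
    · have h1 : -g n (y n) ≤ ‖g n‖ := by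
        rw [← map_neg]
        exact (Real.le_norm_self _).trans ((g n).unit_le_opNorm _ (by simpa using hy n))
      simp only
      linarith [hhy' n, hgpos n]
  obtain ⟨φ, u, hu, hlim⟩ := hZ.exists_subseq_norm_attaining hfin hf hf0 hy hfy
  have hfar : ∀ j, 3 / 2 ≤ ‖y (φ j) - u j‖ := fun j => by
    have h1 := hsub (φ j) (u j) (hu j).1
    rw [(hu j).2] at h1
    have h2 : g (φ j) (u j - y (φ j)) ≤ ‖g (φ j)‖ * ‖y (φ j) - u j‖ := by
      rw [norm_sub_rev]
      exact (Real.le_norm_self _).trans ((g (φ j)).le_opNorm _)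
    rw [map_sub] at h2
    have h3 : ‖g (φ j)‖ * (3 / 2) ≤ ‖g (φ j)‖ * ‖y (φ j) - u j‖ := by linarith [hgy (φ j)]
    exact le_of_mul_le_mul_left h3 (hgpos _)
  have := ge_of_tendsto hlim (Eventually.of_forall hfar)
  linarith

end StrongProximinality

/-! ### Decomposition into finitely many atoms. -/

section Atoms

variable {Ω : Type*} [MeasurableSpace Ω]

/-- A finite measure whose nonzero values are bounded away from zero is carried by finitely many
atoms. -/
theorem MeasureTheory.Measure.exists_finset_atoms (ν : Measure Ω) [IsFiniteMeasure ν] {ε : ℝ}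
    (hsplit : ∀ A, MeasurableSet A → ν A = 0 ∨ ε ≤ ν.real A) (n : ℕ) :
    ∀ S, MeasurableSet S → ν.real S ≤ n * ε → ∃ s : Finset (Set Ω),
      (∀ A ∈ s, MeasurableSet A ∧ A ⊆ S ∧ ν A ≠ 0 ∧
        ∀ U, MeasurableSet U → ν (A ∩ U) = 0 ∨ ν (A \ U) = 0) ∧
      (s : Set (Set Ω)).PairwiseDisjoint id ∧ ν (S \ ⋃ A ∈ s, A) = 0 := by
  classical
  induction n with
  | zero =>
    intro S _ hS0
    refine ⟨∅, by simp, by simp, ?_⟩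
    have : ν.real S = 0 := le_antisymm (by simpa using hS0) measureReal_nonneg
    rw [measureReal_eq_zero_iff] at this
    simpa using this
  | succ n ih =>
    intro S hS hSn
    by_cases hS0 : ν S = 0
    · exact ⟨∅, by simp, by simp, by simpa using hS0⟩
    by_cases hatom : ∀ U, MeasurableSet U → ν (S ∩ U) = 0 ∨ ν (S \ U) = 0
    · exact ⟨{S}, by simpa using ⟨hS, hS0, hatom⟩, by simp, by simp⟩
    push Not at hatom
    obtain ⟨U, hU, h1, h2⟩ := hatom
    have hadd := measureReal_inter_add_sdiff (μ := ν) (s := S) hU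
    -- A non-atom splits into two nonnull pieces, each of mass at least `ε`; each therefore has mass
    -- at most `n * ε` and the induction applies.
    have h1' := (hsplit _ (hS.inter hU)).resolve_left h1
    have h2' := (hsplit _ (hS.diff hU)).resolve_left h2
    push_cast at hSn
    obtain ⟨s, hs, hsd, hs0⟩ := ih (S ∩ U) (hS.inter hU) (by linarith)
    obtain ⟨t, ht, htd, ht0⟩ := ih (S \ U) (hS.diff hU) (by linarith)
    refine ⟨s ∪ t, fun A hA => ?_, ?_, ?_⟩
    · rcases Finset.mem_union.1 hA with hA | hA
      · exact ⟨(hs A hA).1, (hs A hA).2.1.trans Set.inter_subset_left, (hs A hA).2.2⟩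
      · exact ⟨(ht A hA).1, (ht A hA).2.1.trans Set.sdiff_subset, (ht A hA).2.2⟩
    · rw [Finset.coe_union, Set.pairwiseDisjoint_union]
      refine ⟨hsd, htd, fun A hA B hB _ => ?_⟩
      exact Set.disjoint_of_subset (hs A hA).2.1 (ht B hB).2.1
        (Set.disjoint_left.2 fun x hx hx' => hx'.2 hx.2)
    · refine measure_mono_null ?_ (measure_union_null hs0 ht0)
      intro x ⟨hxS, hx⟩
      simp only [Finset.mem_union, Set.mem_iUnion, not_exists] at hx
      by_cases hxU : x ∈ U
      · left
        refine ⟨⟨hxS, hxU⟩, ?_⟩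
        simp only [Set.mem_iUnion, not_exists]
        exact fun A hA hxA => hx A (Or.inl hA) hxA
      · right
        refine ⟨⟨hxS, hxU⟩, ?_⟩
        simp only [Set.mem_iUnion, not_exists]
        exact fun A hA hxA => hx A (Or.inr hA) hxA

/-- Every set `f ⁻¹' U` is null or conull in the atom, and countably many measurable sets separate
the points of `ℝ`. -/
theorem ae_eq_const_of_atom {μ : Measure Ω} {A : Set Ω} (hA : MeasurableSet A)
    (hatom : ∀ U, MeasurableSet U → μ (A ∩ U) = 0 ∨ μ (A \ U) = 0) {f : Ω → ℝ}
    (hf : Measurable f) : ∃ c, ∀ᵐ x ∂μ.restrict A, f x = c := by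
  refine exists_eventuallyEq_const_of_forall_separating MeasurableSet fun U hU => ?_
  rcases hatom _ (hf hU) with h | h
  · right
    rw [ae_restrict_iff' hA, ae_iff]
    refine measure_mono_null (fun x hx => ?_) h
    simpa using hx
  · left
    rw [ae_restrict_iff' hA, ae_iff]
    refine measure_mono_null (fun x hx => ?_) h
    simpa using hx

end Atoms

/-! ### Closedness and transport of `ℓ¹`-summands. -/

section Ell1Summand

variable {E : Type*} [NormedAddCommGroup E] [NormedSpace ℝ E]

/-- The complement in an `ℓ¹`-sum decomposition is automatically closed. -/
theorem isClosed_of_norm_add_eq {F N : Submodule ℝ E} (hFN : IsCompl F N)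
    (h : ∀ f ∈ F, ∀ g ∈ N, ‖f + g‖ = ‖f‖ + ‖g‖) : IsClosed (N : Set E) := by
  refine isClosed_of_closure_subset fun x hx => ?_
  obtain ⟨f, hf, g, hg, rfl⟩ : ∃ f ∈ F, ∃ g ∈ N, f + g = x :=
    Submodule.mem_sup.1 (hFN.sup_eq_top ▸ Submodule.mem_top)
  have hf0 : ‖f‖ ≤ 0 := by
    refine le_of_forall_pos_le_add fun δ hδ => ?_
    obtain ⟨n, hn, hlt⟩ := Metric.mem_closure_iff.1 hx δ hδ
    rw [dist_eq_norm, add_sub_assoc, h f hf _ (N.sub_mem hg hn)] at hlt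
    linarith [norm_nonneg (g - n)]
  rw [norm_le_zero_iff.1 hf0, zero_add]
  exact hg

theorem IsEll1Summand.map {E' : Type*} [NormedAddCommGroup E'] [NormedSpace ℝ E']
    {k : ℕ} {F : Submodule ℝ E} (hF : IsEll1Summand k F) (e : E ≃ₗᵢ[ℝ] E') :
    IsEll1Summand k (F.map (e.toLinearEquiv : E →ₗ[ℝ] E')) := by
  obtain ⟨⟨i⟩, N, -, hFN, h⟩ := hF
  have hcompl : IsCompl (F.map (e.toLinearEquiv : E →ₗ[ℝ] E'))
      (N.map (e.toLinearEquiv : E →ₗ[ℝ] E')) :=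
    hFN.map (Submodule.orderIsoMapComap e.toLinearEquiv)
  have hnorm : ∀ f ∈ F.map (e.toLinearEquiv : E →ₗ[ℝ] E'),
      ∀ g ∈ N.map (e.toLinearEquiv : E →ₗ[ℝ] E'), ‖f + g‖ = ‖f‖ + ‖g‖ := by
    rintro _ ⟨f, hf, rfl⟩ _ ⟨g, hg, rfl⟩
    have := h f hf g hg
    rw [← e.norm_map, ← e.norm_map f, ← e.norm_map g, map_add] at this
    exact this
  refine ⟨⟨LinearIsometryEquiv.trans (LinearIsometryEquiv.symm
    ⟨e.toLinearEquiv.submoduleMap F, fun x => e.norm_map x⟩) i⟩, _,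
    isClosed_of_norm_add_eq hcompl hnorm, hcompl, hnorm⟩

end Ell1Summand

/-! ### Bands of `L¹(μ)` carried by atoms. -/

section L1

variable {Ω : Type*} [MeasurableSpace Ω] {μ : Measure Ω}

theorem exists_lp_indicator (f : Lp ℝ 1 μ) {A : Set Ω} (hA : MeasurableSet A) :
    ∃ g : Lp ℝ 1 μ, g =ᵐ[μ] A.indicator f :=
  ⟨((L1.integrable_coeFn f).indicator hA).toL1 _, Integrable.coeFn_toL1 _⟩

/-- The band of `L¹(μ)` carried by finitely many disjoint atoms is an `ℓ¹`-summand. -/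
theorem exists_isEll1Summand_of_atoms {m : ℕ} (A : Fin m → Set Ω)
    (hA : ∀ i, MeasurableSet (A i)) (hdisj : Pairwise (Function.onFun Disjoint A))
    (hatom : ∀ i, ∀ U, MeasurableSet U → μ (A i ∩ U) = 0 ∨ μ (A i \ U) = 0)
    {h : Ω → ℝ} (hh : Integrable h μ) (hpos : ∀ i, 0 < ∫ x in A i, h x ∂μ) :
    ∃ F : Submodule ℝ (Lp ℝ 1 μ), IsEll1Summand m F ∧
      ∀ f : Lp ℝ 1 μ, (∀ᵐ x ∂μ, x ∉ ⋃ i, A i → f x = 0) → f ∈ F := by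
  classical
  set B : Set Ω := ⋃ i, A i with hB
  have hBm : MeasurableSet B := MeasurableSet.iUnion hA
  let band (C : Set Ω) : Submodule ℝ (Lp ℝ 1 μ) :=
    { carrier := {f | ∀ᵐ x ∂μ, x ∉ C → f x = 0}
      add_mem' := fun {f g} hf hg => by
        filter_upwards [hf, hg, Lp.coeFn_add f g] with x h1 h2 h3 hx
        exact h3.trans (by rw [Pi.add_apply, h1 hx, h2 hx, add_zero])
      zero_mem' := by
        filter_upwards [Lp.coeFn_zero ℝ 1 μ] with x h1 hx
        exact h1
      smul_mem' := fun c f hf => by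
        filter_upwards [hf, Lp.coeFn_smul c f] with x h1 h2 hx
        simp [h2, h1 hx] }
  have hmem : ∀ C (f : Lp ℝ 1 μ), f ∈ band C ↔ ∀ᵐ x ∂μ, x ∉ C → f x = 0 := fun _ _ => Iff.rfl
  have hcompl : IsCompl (band B) (band Bᶜ) := by
    constructor
    · rw [Submodule.disjoint_def]
      intro f h1 h2
      rw [Lp.eq_zero_iff_ae_eq_zero]
      filter_upwards [h1, h2] with x h1 h2
      by_cases hx : x ∈ B
      · exact h2 (by simpa using hx)
      · exact h1 hx
    · rw [codisjoint_iff, eq_top_iff]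
      intro f _
      obtain ⟨g, hg⟩ := exists_lp_indicator f hBm
      refine Submodule.mem_sup.2 ⟨g, ?_, f - g, ?_, by abel⟩
      · rw [hmem]
        filter_upwards [hg] with x hx hxB
        rw [hx, Set.indicator_of_notMem hxB]
      · rw [hmem]
        filter_upwards [hg, Lp.coeFn_sub f g] with x hx hx' hxB
        rw [hx', Pi.sub_apply, hx, Set.indicator_of_mem (by simpa using hxB), sub_self]
  have hnorm : ∀ f ∈ band B, ∀ g ∈ band Bᶜ, ‖f + g‖ = ‖f‖ + ‖g‖ := by
    intro f hf g hg
    rw [L1.norm_eq_integral_norm, L1.norm_eq_integral_norm, L1.norm_eq_integral_norm,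
      ← integral_add (L1.integrable_coeFn f).norm (L1.integrable_coeFn g).norm]
    refine integral_congr_ae ?_
    filter_upwards [hf, hg, Lp.coeFn_add f g] with x h1 h2 h3
    rw [h3]
    by_cases hx : x ∈ B
    · simp [h2 (by simpa using hx)]
    · simp [h1 hx]
  -- Constancy on atoms makes `f ↦ (∫ f over A i)ᵢ` isometric on the band.
  have habs : ∀ (f : Lp ℝ 1 μ) i, |∫ x in A i, f x ∂μ| = ∫ x in A i, ‖f x‖ ∂μ := by
    intro f i
    obtain ⟨c, hc⟩ := ae_eq_const_of_atom (hA i) (hatom i) (Lp.stronglyMeasurable f).measurable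
    rw [integral_congr_ae hc, integral_congr_ae (hc.mono fun x hx => congrArg norm hx),
      integral_const, integral_const, smul_eq_mul, smul_eq_mul, abs_mul,
      abs_of_nonneg measureReal_nonneg, Real.norm_eq_abs]
  have hband : ∀ f ∈ band B, ‖f‖ = ∑ i, ∫ x in A i, ‖f x‖ ∂μ := by
    intro f hf
    rw [← integral_iUnion_fintype hA hdisj fun i => (L1.integrable_coeFn f).norm.integrableOn,
      L1.norm_eq_integral_norm, ← hB]
    refine (setIntegral_eq_integral_of_ae_compl_eq_zero ?_).symm
    filter_upwards [hf] with x hx hxB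
    simp [hx hxB]
  let I : band B →ₗ[ℝ] PiLp 1 (fun _ : Fin m => ℝ) :=
    { toFun := fun f => WithLp.toLp 1 fun i => ∫ x in A i, (f : Lp ℝ 1 μ) x ∂μ
      map_add' := fun f g => by
        ext i
        simp only [PiLp.add_apply]
        rw [← integral_add (L1.integrable_coeFn _).integrableOn (L1.integrable_coeFn _).integrableOn]
        exact integral_congr_ae (ae_restrict_of_ae (Lp.coeFn_add _ _))
      map_smul' := fun c f => by
        ext i
        simp only [PiLp.smul_apply, RingHom.id_apply]
        rw [← integral_smul]
        exact integral_congr_ae (ae_restrict_of_ae (Lp.coeFn_smul _ _)) }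
  let J : band B →ₗᵢ[ℝ] PiLp 1 (fun _ : Fin m => ℝ) :=
    { I with
      norm_map' := fun f => by
        rw [Submodule.coe_norm, hband f f.2, PiLp.norm_eq_of_L1]
        exact Finset.sum_congr rfl fun i _ => habs f i }
  have hsurj : Function.Surjective J := by
    intro a
    -- Multiples of `h` on each `A i` serve as preimages: they are integrable, with nonzero
    -- integral, with no prior assumption that `μ (A i)` is finite.
    let w : Fin m → ℝ := fun i => a i / ∫ x in A i, h x ∂μ
    let φ : Ω → ℝ := fun x => ∑ i, (A i).indicator (fun x => w i * h x) x
    have hφ : Integrable φ μ :=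
      integrable_finsetSum _ fun i _ => (hh.const_mul _).indicator (hA i)
    have hφmem : hφ.toL1 φ ∈ band B := by
      rw [hmem]
      filter_upwards [hφ.coeFn_toL1] with x hx hxB
      rw [hx]
      refine Finset.sum_eq_zero fun i _ => Set.indicator_of_notMem (fun hxi => hxB ?_) _
      exact Set.mem_iUnion.2 ⟨i, hxi⟩
    refine ⟨⟨_, hφmem⟩, ?_⟩
    ext i
    change ∫ x in A i, (hφ.toL1 φ) x ∂μ = a i
    have h1 : ∫ x in A i, (hφ.toL1 φ) x ∂μ = ∫ x in A i, w i * h x ∂μ := by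
      rw [integral_congr_ae (ae_restrict_of_ae hφ.coeFn_toL1)]
      refine setIntegral_congr_fun (hA i) fun x hx => ?_
      simp only [φ]
      rw [Finset.sum_eq_single i, Set.indicator_of_mem hx]
      · intro j _ hj
        exact Set.indicator_of_notMem (Set.disjoint_left.1 (hdisj hj.symm) hx) _
      · simp
    rw [h1, integral_const_mul]
    exact div_mul_cancel₀ _ (hpos i).ne'
  exact ⟨band B, ⟨⟨LinearIsometryEquiv.ofSurjective J hsurj⟩, band Bᶜ,
    isClosed_of_norm_add_eq hcompl hnorm, hcompl, hnorm⟩, fun f hf => hf⟩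

/-- If the restrictions of `f ∈ L¹(μ)` are not small L-summands, then the measure `|f| μ` does
not take small nonzero values. -/
theorem exists_le_setIntegral_norm (f : Lp ℝ 1 μ)
    (hf : ∃ ε > 0, ∀ g : Lp ℝ 1 μ, ‖f - g‖ + ‖g‖ = ‖f‖ → ‖f - g - g‖ = ‖f‖ → g = 0 ∨ ε ≤ ‖g‖) :
    ∃ ε > 0, ∀ A, MeasurableSet A → ∫ x in A, ‖f x‖ ∂μ = 0 ∨ ε ≤ ∫ x in A, ‖f x‖ ∂μ := by
  obtain ⟨ε, hε, hsplit⟩ := hf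
  refine ⟨ε, hε, fun A hA => ?_⟩
  -- For `g = 1_A f`, the functions `f - g` and `g` have disjoint supports and `f - 2 g = ± f`
  -- pointwise, so `g` is an admissible splitting.
  obtain ⟨g, hg⟩ := exists_lp_indicator f hA
  have hnorm : ‖g‖ = ∫ x in A, ‖f x‖ ∂μ := by
    rw [L1.norm_eq_integral_norm, ← integral_indicator hA]
    refine integral_congr_ae ?_
    filter_upwards [hg] with x hx
    rw [hx, norm_indicator_eq_indicator_norm]
  have h1 : ‖f - g‖ + ‖g‖ = ‖f‖ := by
    rw [L1.norm_eq_integral_norm, L1.norm_eq_integral_norm, L1.norm_eq_integral_norm,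
      ← integral_add (L1.integrable_coeFn _).norm (L1.integrable_coeFn g).norm]
    refine integral_congr_ae ?_
    filter_upwards [hg, Lp.coeFn_sub f g] with x hx hx'
    rw [hx', Pi.sub_apply, hx]
    by_cases hxA : x ∈ A <;> simp [hxA]
  have h2 : ‖f - g - g‖ = ‖f‖ := by
    rw [L1.norm_eq_integral_norm, L1.norm_eq_integral_norm]
    refine integral_congr_ae ?_
    filter_upwards [hg, Lp.coeFn_sub f g, Lp.coeFn_sub (f - g) g] with x hx hx' hx''
    rw [hx'', Pi.sub_apply, hx', Pi.sub_apply, hx]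
    by_cases hxA : x ∈ A <;> simp [hxA]
  rw [← hnorm]
  exact (hsplit g h1 h2).imp_left fun h => by rw [h, norm_zero]

/-- A finite-dimensional subspace of `L¹(μ)` whose elements have no small L-summands lies in an
`ℓ¹`-summand. -/
theorem exists_isEll1Summand_of_split (G : Submodule ℝ (Lp ℝ 1 μ)) [FiniteDimensional ℝ G]
    (hG : ∀ f ∈ G, ∃ ε > 0, ∀ g : Lp ℝ 1 μ,
      ‖f - g‖ + ‖g‖ = ‖f‖ → ‖f - g - g‖ = ‖f‖ → g = 0 ∨ ε ≤ ‖g‖) :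
    ∃ m, ∃ F : Submodule ℝ (Lp ℝ 1 μ), IsEll1Summand m F ∧ G ≤ F := by
  classical
  let b := Module.finBasis ℝ G
  let f : Fin (Module.finrank ℝ G) → Lp ℝ 1 μ := fun i => b i
  choose ε hε hsplit using fun i => exists_le_setIntegral_norm (f i) (hG _ (b i).2)
  obtain ⟨δ, hδ, hδε⟩ : ∃ δ > 0, ∀ i, δ ≤ ε i := by
    rcases isEmpty_or_nonempty (Fin (Module.finrank ℝ G)) with hemp | hne
    · exact ⟨1, one_pos, fun i => hemp.elim i⟩
    · obtain ⟨i, hi⟩ := Finite.exists_min ε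
      exact ⟨ε i, hε i, hi⟩
  -- The sum of the `|fᵢ|` dominates every basis vector, so the atoms of `ν = h μ` carry all of `G`;
  -- on `{h ≠ 0}`, `ν`-null sets are `μ`-null.
  let h : Ω → ℝ := fun x => ∑ i, ‖f i x‖
  have hh0 : ∀ x, 0 ≤ h x := fun x => Finset.sum_nonneg fun _ _ => norm_nonneg _
  have hh : Integrable h μ := integrable_finsetSum _ fun i _ => (L1.integrable_coeFn (f i)).norm
  have hhm : Measurable h := Finset.measurable_sum _ fun i _ =>
    (Lp.stronglyMeasurable (f i)).measurable.norm
  let ν : Measure Ω := μ.withDensity fun x => ENNReal.ofReal (h x)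
  have : IsFiniteMeasure ν := isFiniteMeasure_withDensity_ofReal hh.2
  have hν : ∀ A, MeasurableSet A → ν A = ENNReal.ofReal (∫ x in A, h x ∂μ) := fun A hA => by
    rw [withDensity_apply _ hA, ofReal_integral_eq_lintegral_ofReal hh.integrableOn
      (Eventually.of_forall hh0)]
  have hsum : ∀ A, ∫ x in A, h x ∂μ = ∑ i, ∫ x in A, ‖f i x‖ ∂μ := fun A =>
    integral_finsetSum _ fun i _ => (L1.integrable_coeFn (f i)).norm.integrableOn
  have hint0 : ∀ A, 0 ≤ ∫ x in A, h x ∂μ := fun A => integral_nonneg hh0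
  have hνsplit : ∀ A, MeasurableSet A → ν A = 0 ∨ δ ≤ ν.real A := by
    intro A hA
    rw [measureReal_def, hν A hA, ENNReal.toReal_ofReal (hint0 A), hsum]
    by_cases hall : ∀ i, ∫ x in A, ‖f i x‖ ∂μ = 0
    · left
      rw [Finset.sum_eq_zero fun i _ => hall i, ENNReal.ofReal_zero]
    · right
      push Not at hall
      obtain ⟨i, hi⟩ := hall
      exact (hδε i).trans (((hsplit i A hA).resolve_left hi).trans
        (Finset.single_le_sum (f := fun i => ∫ x in A, ‖f i x‖ ∂μ)
          (fun j _ => integral_nonneg fun _ => norm_nonneg _) (Finset.mem_univ i)))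
  obtain ⟨n, hn⟩ := exists_nat_ge (ν.real {x | h x ≠ 0} / δ)
  have hBm : MeasurableSet {x | h x ≠ 0} := hhm (measurableSet_singleton 0).compl
  obtain ⟨s, hs, hsd, hs0⟩ := ν.exists_finset_atoms hνsplit n _ hBm ((div_le_iff₀ hδ).1 hn)
  let A : Fin s.card → Set Ω := fun i => (s.equivFin.symm i : Set Ω)
  have hAs : ∀ i, A i ∈ s := fun i => (s.equivFin.symm i).2
  have hμν : ∀ V ⊆ {x | h x ≠ 0}, MeasurableSet V → ν V = 0 → μ V = 0 := by
    intro V hV hVm hV0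
    rw [withDensity_apply_eq_zero hhm.ennreal_ofReal] at hV0
    refine measure_mono_null (t := {x | ENNReal.ofReal (h x) ≠ 0} ∩ V) (fun x hx => ⟨?_, hx⟩) hV0
    have : 0 < h x := lt_of_le_of_ne (hh0 x) (Ne.symm (hV hx))
    simpa using this
  obtain ⟨F, hF, hFmem⟩ := exists_isEll1Summand_of_atoms (μ := μ) A (fun i => (hs _ (hAs i)).1)
    (fun i j hij => hsd (hAs i) (hAs j) fun heq => hij
      (s.equivFin.symm.injective (Subtype.ext heq)))
    (fun i U hU => by
      obtain ⟨h1, h2, -, h3⟩ := hs _ (hAs i)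
      exact (h3 U hU).imp (hμν _ (Set.inter_subset_left.trans h2) (h1.inter hU))
        (hμν _ (Set.sdiff_subset.trans h2) (h1.diff hU))) hh
    (fun i => by
      obtain ⟨h1, -, h3, -⟩ := hs _ (hAs i)
      rw [hν _ h1] at h3
      exact ENNReal.ofReal_pos.1 (pos_iff_ne_zero.2 h3))
  have hunion : ⋃ i, A i = ⋃ C ∈ s, C := by
    ext x
    simp only [Set.mem_iUnion, exists_prop]
    exact ⟨fun ⟨i, hi⟩ => ⟨_, hAs i, hi⟩, fun ⟨C, hC, hx⟩ =>
      ⟨s.equivFin ⟨C, hC⟩, by simpa [A] using hx⟩⟩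
  refine ⟨s.card, F, hF, ?_⟩
  have hfF : ∀ i, f i ∈ F := by
    intro i
    refine hFmem _ ?_
    rw [hunion]
    have hnull : μ ({x | h x ≠ 0} \ ⋃ C ∈ s, C) = 0 :=
      hμν _ Set.sdiff_subset (hBm.diff (Finset.measurableSet_biUnion _ fun C hC => (hs C hC).1)) hs0
    filter_upwards [measure_eq_zero_iff_ae_notMem.1 hnull] with x hx hxs
    by_contra hne
    refine hx ⟨?_, hxs⟩
    have : 0 < h x := lt_of_lt_of_le (norm_pos_iff.2 hne)
      (Finset.single_le_sum (f := fun i => ‖f i x‖) (fun _ _ => norm_nonneg _) (Finset.mem_univ i))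
    exact this.ne'
  intro g hg
  have hrepr := congrArg (Subtype.val) (b.sum_repr ⟨g, hg⟩)
  rw [← show _ = g from hrepr]
  simp only [AddSubmonoidClass.coe_finsetSum, SetLike.val_smul]
  exact F.sum_mem fun i _ => F.smul_mem _ (hfF i)

end L1

/-! ### The annihilator of `Z` and the main theorem. -/

theorem finiteDimensional_polarSubmodule {Y : Type*} [NormedAddCommGroup Y] [NormedSpace ℝ Y]
    (Z : Submodule ℝ Y) [FiniteDimensional ℝ (Y ⧸ Z)] :
    FiniteDimensional ℝ (StrongDual.polarSubmodule ℝ Z) := by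
  have hZ : ∀ g : StrongDual.polarSubmodule ℝ Z, ∀ z ∈ Z, (g : StrongDual ℝ Y) z = 0 := fun g =>
    (StrongDual.mem_polarSubmodule ℝ Z g).1 g.2
  let T : StrongDual.polarSubmodule ℝ Z →ₗ[ℝ] Module.Dual ℝ (Y ⧸ Z) :=
    { toFun := fun g => Z.liftQ ((g : StrongDual ℝ Y) : Y →ₗ[ℝ] ℝ) fun z hz => hZ g z hz
      map_add' := fun g h => by ext y; rfl
      map_smul' := fun c g => by ext y; rfl }
  refine FiniteDimensional.of_injective T fun g h hgh => ?_
  ext y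
  exact LinearMap.congr_fun hgh (Z.mkQ y)

/-- The annihilator of a strongly proximinal subspace of finite codimension of an `L¹`-predual
lies in an `ℓ¹`-summand of the dual. -/
theorem IsStronglyProximinal.exists_isEll1Summand {Y : Type*} [NormedAddCommGroup Y]
    [NormedSpace ℝ Y] {Ω : Type*} [MeasurableSpace Ω] {μ : Measure Ω} (hY : IsL1PredualVia Y μ)
    {Z : Submodule ℝ Y} (hZ : IsStronglyProximinal Z) (hfin : FiniteDimensional ℝ (Y ⧸ Z)) :
    ∃ m, ∃ F : Submodule ℝ (StrongDual ℝ Y), IsEll1Summand m F ∧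
      StrongDual.polarSubmodule ℝ Z ≤ F := by
  obtain ⟨e⟩ := hY
  have := finiteDimensional_polarSubmodule Z
  obtain ⟨m, F, hF, hle⟩ := exists_isEll1Summand_of_split
    ((StrongDual.polarSubmodule ℝ Z).map (e.toLinearEquiv : StrongDual ℝ Y →ₗ[ℝ] Lp ℝ 1 μ)) <| by
      rintro _ ⟨f, hf, rfl⟩
      obtain ⟨ε, hε, hsplit⟩ := hZ.exists_le_norm_of_split hfin
        ((StrongDual.mem_polarSubmodule ℝ Z f).1 hf)
      refine ⟨ε, hε, fun g h1 h2 => ?_⟩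
      obtain ⟨g, rfl⟩ := e.surjective g
      change ‖e f - e g‖ + ‖e g‖ = ‖e f‖ at h1
      change ‖e f - e g - e g‖ = ‖e f‖ at h2
      rw [← map_sub, e.norm_map, e.norm_map, e.norm_map] at h1
      rw [← map_sub, ← map_sub, e.norm_map, e.norm_map] at h2
      rw [e.norm_map]
      exact (hsplit g h1 h2).imp_left fun h => by rw [h, map_zero]
  refine ⟨m, _, hF.map e.symm, fun f hf => ⟨e f, hle ⟨f, hf, rfl⟩, e.symm_apply_apply f⟩⟩

theorem theorem6 {X : Type*} [NormedAddCommGroup X] [NormedSpace ℝ X] [CompleteSpace X]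
    (hX : IsReflexiveSpace X)
    {Y : Type*} [NormedAddCommGroup Y] [NormedSpace ℝ Y] [CompleteSpace Y]
    {Ω : Type*} [MeasurableSpace Ω] (μ : Measure Ω) (hY : IsL1PredualVia Y μ)
    (Z : Submodule ℝ Y) (hZ : IsStronglyProximinal Z) (hfin : FiniteDimensional ℝ (Y ⧸ Z)) :
    ∃ k : ℕ,
      IsLeast {m : ℕ | ∃ F : Submodule ℝ (StrongDual ℝ Y),
        IsEll1Summand m F ∧ StrongDual.polarSubmodule ℝ Z ≤ F} k ∧
      ∀ F : Submodule ℝ (StrongDual ℝ Y),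
        IsEll1Summand k F → StrongDual.polarSubmodule ℝ Z ≤ F →
        (StrongDual.polarSubmodule ℝ (compactOpsInto X Z) :
          Set (StrongDual ℝ (CompactOps X Y))) ⊆ projTensor X F →
        IsProximinal (compactOpsInto X Z) := by
  classical
  have hex := hZ.exists_isEll1Summand hY hfin
  refine ⟨Nat.find hex, ⟨Nat.find_spec hex, fun m hm => Nat.find_min' hex hm⟩, ?_⟩
  intro F hF hZF _
  exact isProximinal_compactOpsInto_of_isEll1Summand hZ.1.1 hF hZF
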